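/- Let $k\in\mathbb N_0=\{0,1,2,\dots\}$ and let $I\subseteq\mathbb R$ be an interval (of any kind, bounded or not) containing more than one point. Let $C(I)$ be the algebra of continuous real functions on $I$, and let $C^k(I)$ be the algebra of all real functions that are $k$ times continuously differentiable on $I$ (with one-sided derivatives at the end points belonging to $I$), so that $C^0(I)=C(I)$. Let $T\colon C^k(I)\to C(I)$ be additive, that is, $T(f+g)=T(f)+T(g)$. (A) The following conditions are pairwise equivalent: 1. $T(f^2)=2f\,T(f)$ for all $f\in C^k(I)$; 2. $T(fg)=f\,T(g)+g\,T(f)$ for all $f,g\in C^k(I)$; 3. $T(f^n)=nf^{n-1}\,T(f)$ for all $f\in C^k(I)$ and all integers $n\ge1$; and each of them is equivalent, if $k>0$, to (x) there exists $d\in C(I)$ such that $T(f)=d\cdot f'$ for all $f\in C^k(I)$, and, if $k=0$, to $T=0$. (B) If moreover $I$ is compact, then the following conditions are pairwise equivalent: 1. $T(fg)=f\,T(g)+g\,T(f)$ for all $f,g\in C^k(I)$; 2. $T(fg)=f\,T(g)+g\,T(f)$ for all $f,g\in C^k(I)$ with $f>0$ and $g>0$; 3. $T(f^2)=2f\,T(f)$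 for all $f\in C^k(I)$; 4. $T(f^2)=2f\,T(f)$ for all $f\in C^k(I)$ with $f>0$; 5. $T(f)=-f^2\,T(1/f)$ for all $f\in C^k(I)$ with $f>0$; 6. $T(f^n)=nf^{n-1}\,T(f)$ for all $f\in C^k(I)$ and all integers $n\ge1$; 7. $T(f^n)=nf^{n-1}\,T(f)$ for all $f\in C^k(I)$ with $f>0$ and all integers $n\ge1$; and each of them is equivalent, if $k>0$, to (x), and, if $k=0$, to $T=0$. The same holds if $C^k(I)$ is replaced by the larger algebra of all functions that are continuous on $I$ and $k$ times continuously differentiable on the interior of $I$; in that case the equation $T(f)=d\cdot f'$ in (x) is required at all points of $I$ at which $f$ is differentiable (one-sidedly at end points), in particular at all interior points. -/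

import Mathlib

namespace SmoothDerivation

noncomputable section

/-- A function given on `I`, viewed as a function on `ℝ` by putting it equal to `0` outside `I`. Below
only its values on `I`, and limits and derivatives taken within subsets of `I`, are ever used. -/
def ext {I : Set ℝ} (f : C(I, ℝ)) : ℝ → ℝ :=
  Function.extend Subtype.val f 0

theorem ext_apply {I : Set ℝ} (f : C(I, ℝ)) (x : I) : ext f x = f x :=
  Subtype.val_injective.extend_apply f 0 x

/-- The continuous functions on `I` that are `k` times continuously differentiable on `S ⊆ I`. -/
def ckOn (k : ℕ) (I S : Set ℝ) (hS : S ⊆ I) : Subalgebra ℝ C(I, ℝ) where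
  carrier := {f | ContDiffOn ℝ k (ext f) S}
  mul_mem' {f g} hf hg := (ContDiffOn.mul hf hg).congr fun x hx => by
    simpa using (by
      rw [ext_apply (f * g) ⟨x, hS hx⟩, ext_apply f ⟨x, hS hx⟩, ext_apply g ⟨x, hS hx⟩]; rfl :
      ext (f * g) (⟨x, hS hx⟩ : I) = ext f (⟨x, hS hx⟩ : I) * ext g (⟨x, hS hx⟩ : I))
  add_mem' {f g} hf hg := (ContDiffOn.add hf hg).congr fun x hx => by
    simpa using (by
      rw [ext_apply (f + g) ⟨x, hS hx⟩, ext_apply f ⟨x, hS hx⟩, ext_apply g ⟨x, hS hx⟩]; rfl :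
      ext (f + g) (⟨x, hS hx⟩ : I) = ext f (⟨x, hS hx⟩ : I) + ext g (⟨x, hS hx⟩ : I))
  algebraMap_mem' r := (contDiffOn_const (c := r)).congr fun x hx => by
    simpa using ext_apply (algebraMap ℝ C(I, ℝ) r) ⟨x, hS hx⟩

/-- `C^k(I)` in the usual sense: `k` times continuously differentiable on all of `I`, with one-sided
derivatives at the end points that belong to `I`. -/
def ck (k : ℕ) (I : Set ℝ) : Subalgebra ℝ C(I, ℝ) :=
  ckOn k I I subset_rfl

/-- The variant of `C^k(I)` in which differentiability is required on the interior of `I` only: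
continuous on `I` and `k` times continuously differentiable on the interior. -/
def ckInt (k : ℕ) (I : Set ℝ) : Subalgebra ℝ C(I, ℝ) :=
  ckOn k I (interior I) interior_subset

section

variable {I : Set ℝ} {A : Subalgebra ℝ C(I, ℝ)}

/-- `f > 0` on `I`. -/
def Pos (f : A) : Prop :=
  ∀ x : I, 0 < (f : C(I, ℝ)) x

/-- `T(f g) = f T(g) + g T(f)` for all `f`, `g`. -/
def Leibniz (T : A →+ C(I, ℝ)) : Prop :=
  ∀ f g : A, T (f * g) = (f : C(I, ℝ)) * T g + (g : C(I, ℝ)) * T f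

/-- `T(f g) = f T(g) + g T(f)` for all `f > 0`, `g > 0`. -/
def LeibnizPos (T : A →+ C(I, ℝ)) : Prop :=
  ∀ f g : A, Pos f → Pos g → T (f * g) = (f : C(I, ℝ)) * T g + (g : C(I, ℝ)) * T f

/-- `T(f²) = 2 f T(f)` for all `f`. -/
def SquareRule (T : A →+ C(I, ℝ)) : Prop :=
  ∀ f : A, T (f ^ 2) = 2 * (f : C(I, ℝ)) * T f

/-- `T(f²) = 2 f T(f)` for all `f > 0`. -/
def SquareRulePos (T : A →+ C(I, ℝ)) : Prop :=
  ∀ f : A, Pos f → T (f ^ 2) = 2 * (f : C(I, ℝ)) * T f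

/-- `T(f) = - f² T(1/f)` for all `f > 0`. Here `g` is the function `1/f`, which lies in the algebra
by `exists_inv_ck` and `exists_inv_ckInt`. -/
def InverseRulePos (T : A →+ C(I, ℝ)) : Prop :=
  ∀ f g : A, Pos f → (∀ x : I, (g : C(I, ℝ)) x = 1 / (f : C(I, ℝ)) x) →
    T f = -(f : C(I, ℝ)) ^ 2 * T g

/-- `T(fⁿ) = n fⁿ⁻¹ T(f)` for all `f` and all `n = 1, 2, …`. -/
def PowerRule (T : A →+ C(I, ℝ)) : Prop :=
  ∀ (f : A) (n : ℕ), 1 ≤ n → T (f ^ n) = (n : C(I, ℝ)) * (f : C(I, ℝ)) ^ (n - 1) * T f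

/-- `T(fⁿ) = n fⁿ⁻¹ T(f)` for all `f > 0` and all `n = 1, 2, …`. -/
def PowerRulePos (T : A →+ C(I, ℝ)) : Prop :=
  ∀ (f : A) (n : ℕ), Pos f → 1 ≤ n →
    T (f ^ n) = (n : C(I, ℝ)) * (f : C(I, ℝ)) ^ (n - 1) * T f

/-- There is `d ∈ C(I)` with `T(f) = d f'` for all `f`. The equation is required at every point of `I`
at which `f` has a derivative (one-sided at an end point): for `A = ck k I` with `k > 0` these are all
points of `I`, for `A = ckInt k I` all interior points and possibly end points. -/
def IsMultipleOfDeriv (T : A →+ C(I, ℝ)) : Prop :=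
  ∃ d : C(I, ℝ), ∀ (f : A) (x : I) (f' : ℝ),
    HasDerivWithinAt (ext (f : C(I, ℝ))) f' I x → T f x = d x * f'

theorem exists_inv_ckOn {k : ℕ} {S : Set ℝ} {hS : S ⊆ I} (f : ckOn k I S hS) (hf : Pos f) :
    ∃ g : ckOn k I S hS, ∀ x : I, (g : C(I, ℝ)) x = 1 / (f : C(I, ℝ)) x := by
  let g : C(I, ℝ) := ⟨fun x => 1 / (f : C(I, ℝ)) x,
    continuous_const.div (f : C(I, ℝ)).continuous fun x => (hf x).ne'⟩
  have hval : ∀ x ∈ S, ∃ y : I, ext (f : C(I, ℝ)) x = (f : C(I, ℝ)) y ∧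
      ext g x = 1 / (f : C(I, ℝ)) y := fun x hx =>
    ⟨⟨x, hS hx⟩, ext_apply (f : C(I, ℝ)) ⟨x, hS hx⟩, ext_apply g ⟨x, hS hx⟩⟩
  have h : ContDiffOn ℝ k (ext (f : C(I, ℝ))) S := f.2
  have hg : ContDiffOn ℝ k (ext g) S := by
    refine (h.inv fun x hx => ?_).congr fun x hx => ?_
    · obtain ⟨y, h1, -⟩ := hval x hx
      rw [h1]
      exact (hf y).ne'
    · obtain ⟨y, h1, h2⟩ := hval x hx
      simp [h1, h2]
  exact ⟨⟨g, hg⟩, fun x => rfl⟩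

theorem exists_inv_ck {k : ℕ} (f : ck k I) (hf : Pos f) :
    ∃ g : ck k I, ∀ x : I, (g : C(I, ℝ)) x = 1 / (f : C(I, ℝ)) x :=
  exists_inv_ckOn f hf

theorem exists_inv_ckInt {k : ℕ} (f : ckInt k I) (hf : Pos f) :
    ∃ g : ckInt k I, ∀ x : I, (g : C(I, ℝ)) x = 1 / (f : C(I, ℝ)) x :=
  exists_inv_ckOn f hf

end

end

end SmoothDerivation

/-! The algebraic equivalences rest on the defect `leibnizDefect T f g`, which is symmetric and
biadditive. If it vanishes on the diagonal, it vanishes by polarisation. Positive functions are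
closed under addition, so the same argument works for them. On a compact `I` they generate the
algebra additively, so rules for positive functions extend to all functions.

For the analytic part let `T` satisfy the Leibniz rule. Multiplying by a bump function shows that
`T` is local. As `T` is only additive, it could a priori act on constants as a nonzero derivation of
`ℝ`. Such a map is unbounded near `0`, so a `C^k` function with suitable tiny constant values near
points converging to `x` would have an image that is unbounded near `x`, contradicting continuity
(`Leibniz.map_algebraMap`). Hence `T P = T(id) P'` for polynomials.

If the `k`-jet of `F` vanishes at an interior point `x`, then `F` is the sum of two `C^k` functions,
each vanishing on one side of `x`; locality and continuity give `T F x = 0`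
(`Leibniz.apply_restrict_eq_zero`). So `T f x` depends only on the `k`-jet of `f`, and `f` may be
replaced by its Taylor polynomial of degree at most `k`. This yields `T f = T(id) f'` in the
interior if `k > 0`, and `T = 0` if `k = 0`. End points follow from the mean value theorem and
continuity. -/

namespace SmoothDerivation

open Filter Topology Set

/-! ### Polarisation and the algebraic implications -/

section Algebra

variable {I : Set ℝ} {A : Subalgebra ℝ C(I, ℝ)} {T : A →+ C(I, ℝ)}

/-- The failure of the Leibniz rule for the pair `f`, `g`. -/
def leibnizDefect (T : A →+ C(I, ℝ)) (f g : A) : C(I, ℝ) :=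
  T (f * g) - ((f : C(I, ℝ)) * T g + (g : C(I, ℝ)) * T f)

theorem leibnizDefect_eq_zero_iff {f g : A} : leibnizDefect T f g = 0 ↔
    T (f * g) = (f : C(I, ℝ)) * T g + (g : C(I, ℝ)) * T f :=
  sub_eq_zero

theorem leibnizDefect_comm (f g : A) : leibnizDefect T f g = leibnizDefect T g f := by
  simp only [leibnizDefect, mul_comm f g]
  ring

theorem leibnizDefect_sub_left (f f' g : A) :
    leibnizDefect T (f - f') g = leibnizDefect T f g - leibnizDefect T f' g := by
  simp only [leibnizDefect, sub_mul, map_sub, AddSubgroupClass.coe_sub]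
  ring

theorem leibnizDefect_add_left (f f' g : A) :
    leibnizDefect T (f + f') g = leibnizDefect T f g + leibnizDefect T f' g := by
  simp only [leibnizDefect, add_mul, map_add, Subalgebra.coe_add]
  ring

theorem leibnizDefect_sub_right (f g g' : A) :
    leibnizDefect T f (g - g') = leibnizDefect T f g - leibnizDefect T f g' := by
  rw [leibnizDefect_comm, leibnizDefect_sub_left, leibnizDefect_comm g, leibnizDefect_comm g']

theorem leibnizDefect_add_right (f g g' : A) :
    leibnizDefect T f (g + g') = leibnizDefect T f g + leibnizDefect T f g' := by
  rw [leibnizDefect_comm, leibnizDefect_add_left, leibnizDefect_comm g, leibnizDefect_comm g']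

theorem leibnizDefect_self_eq_zero_iff {f : A} : leibnizDefect T f f = 0 ↔
    T (f ^ 2) = 2 * (f : C(I, ℝ)) * T f := by
  rw [leibnizDefect_eq_zero_iff, sq, ← two_mul, mul_assoc]

/-- Expanding the defect at `(f + g, f + g)` leaves twice the mixed term. Only three diagonal values
enter, so the argument also applies within the positive functions. -/
theorem leibnizDefect_eq_zero_of_self {f g : A} (hf : leibnizDefect T f f = 0)
    (hg : leibnizDefect T g g = 0) (hfg : leibnizDefect T (f + g) (f + g) = 0) :
    leibnizDefect T f g = 0 := by
  rw [leibnizDefect_add_left, leibnizDefect_add_right, leibnizDefect_add_right, hf, hg,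
    leibnizDefect_comm g f, zero_add, add_zero] at hfg
  ext x
  have := DFunLike.congr_fun hfg x
  simp only [ContinuousMap.add_apply, ContinuousMap.zero_apply] at this ⊢
  linarith

theorem Pos.add {f g : A} (hf : Pos f) (hg : Pos g) : Pos (f + g) :=
  fun x => add_pos (hf x) (hg x)

theorem pos_one : Pos (1 : A) := fun _ => one_pos

theorem SquareRule.leibniz (h : SquareRule T) : Leibniz T := fun f g =>
  leibnizDefect_eq_zero_iff.1 <| leibnizDefect_eq_zero_of_self
    (leibnizDefect_self_eq_zero_iff.2 (h f)) (leibnizDefect_self_eq_zero_iff.2 (h g))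
    (leibnizDefect_self_eq_zero_iff.2 (h (f + g)))

theorem SquareRulePos.leibnizPos (h : SquareRulePos T) : LeibnizPos T := fun f g hf hg =>
  leibnizDefect_eq_zero_iff.1 <| leibnizDefect_eq_zero_of_self
    (leibnizDefect_self_eq_zero_iff.2 (h f hf)) (leibnizDefect_self_eq_zero_iff.2 (h g hg))
    (leibnizDefect_self_eq_zero_iff.2 (h (f + g) (hf.add hg)))

theorem Leibniz.powerRule (h : Leibniz T) : PowerRule T := by
  intro f n hn
  induction n, hn using Nat.le_induction with
  | base => simp
  | succ n hn ih =>
    obtain ⟨m, rfl⟩ := Nat.exists_eq_add_of_le' hn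
    rw [pow_succ, h, ih]
    simp only [SubmonoidClass.coe_pow, add_tsub_cancel_right]
    push_cast
    ring

theorem PowerRule.squareRule (h : PowerRule T) : SquareRule T := fun f => by
  simpa using h f 2 one_le_two

theorem PowerRulePos.squareRulePos (h : PowerRulePos T) : SquareRulePos T := fun f hf => by
  simpa using h f 2 hf one_le_two

theorem PowerRule.pos (h : PowerRule T) : PowerRulePos T := fun f n _ hn => h f n hn

theorem Leibniz.pos (h : Leibniz T) : LeibnizPos T := fun f g _ _ => h f g

theorem LeibnizPos.squareRulePos (h : LeibnizPos T) : SquareRulePos T := fun f hf =>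
  leibnizDefect_self_eq_zero_iff.1 (leibnizDefect_eq_zero_iff.2 (h f f hf hf))

theorem Leibniz.map_one (h : Leibniz T) : T 1 = 0 := by
  have := h 1 1
  simp only [mul_one, OneMemClass.coe_one, one_mul] at this
  exact left_eq_add.1 this

theorem Leibniz.inverseRulePos (h : Leibniz T) : InverseRulePos T := by
  intro f g hf hg
  have hfg : f * g = 1 := by
    ext x
    simp [hg x, (hf x).ne']
  have h1 := h f g
  rw [hfg, h.map_one] at h1
  have hfg' : (f : C(I, ℝ)) * g = 1 := congrArg Subtype.val hfg
  linear_combination (-(f : C(I, ℝ))) * h1 - T f * hfg'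

/-- On a compact set every function is a difference of two positive ones. -/
theorem exists_pos_sub_pos (hI : IsCompact I) (f : A) : ∃ g h : A, Pos g ∧ Pos h ∧ f = g - h := by
  have : CompactSpace I := isCompact_iff_compactSpace.1 hI
  let c : ℝ := ‖(f : C(I, ℝ))‖ + 1
  have hc (x : I) : (algebraMap ℝ A c : C(I, ℝ)) x = c := rfl
  refine ⟨f + algebraMap ℝ A c, algebraMap ℝ A c, fun x => ?_, fun x => ?_, by ring⟩
  · have := (abs_le.1 ((f : C(I, ℝ)).norm_coe_le_norm x)).1
    simp only [Subalgebra.coe_add, ContinuousMap.add_apply, hc, c]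
    linarith
  · rw [hc]
    positivity

theorem LeibnizPos.leibniz (hI : IsCompact I) (h : LeibnizPos T) : Leibniz T := by
  intro f g
  obtain ⟨f₁, f₂, hf₁, hf₂, rfl⟩ := exists_pos_sub_pos hI f
  obtain ⟨g₁, g₂, hg₁, hg₂, rfl⟩ := exists_pos_sub_pos hI g
  have key {a b : A} (ha : Pos a) (hb : Pos b) : leibnizDefect T a b = 0 :=
    leibnizDefect_eq_zero_iff.2 (h a b ha hb)
  rw [← leibnizDefect_eq_zero_iff, leibnizDefect_sub_left, leibnizDefect_sub_right,
    leibnizDefect_sub_right, key hf₁ hg₁, key hf₁ hg₂, key hf₂ hg₁, key hf₂ hg₂]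
  simp

/-- From `1/f - 1/(f+1) = 1/(f²+f)`. -/
theorem InverseRulePos.squareRulePos
    (hinv : ∀ f : A, Pos f → ∃ g : A, ∀ x : I, (g : C(I, ℝ)) x = 1 / (f : C(I, ℝ)) x)
    (h : InverseRulePos T) : SquareRulePos T := by
  intro f hf
  have hT1 : T 1 = 0 := by
    have := h 1 1 pos_one (by simp)
    ext x
    have := DFunLike.congr_fun this x
    simp at this ⊢
    linarith
  have hf1 : Pos (f + 1) := hf.add pos_one
  have hf2 : Pos (f ^ 2 + f) := fun x => by
    have := hf x
    simp only [Subalgebra.coe_add, SubmonoidClass.coe_pow, ContinuousMap.add_apply,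
      ContinuousMap.pow_apply]
    positivity
  obtain ⟨g, hg⟩ := hinv f hf
  obtain ⟨g₁, hg₁⟩ := hinv _ hf1
  obtain ⟨g₂, hg₂⟩ := hinv _ hf2
  have hsub : g₂ = g - g₁ := by
    ext x
    have := hf x
    simp only [AddSubgroupClass.coe_sub, ContinuousMap.sub_apply, hg, hg₁, hg₂,
      Subalgebra.coe_add, SubmonoidClass.coe_pow, ContinuousMap.add_apply,
      ContinuousMap.pow_apply, OneMemClass.coe_one, ContinuousMap.one_apply]
    field_simp
    ring
  have e := h f g hf hg
  have e₁ := h _ g₁ hf1 hg₁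
  have e₂ := h _ g₂ hf2 hg₂
  rw [map_add, hT1, add_zero] at e₁
  rw [map_add, hsub, map_sub] at e₂
  push_cast at e₁ e₂
  -- Eliminating `T g` and `T g₁` gives `T(f²) + T f = ((f + 1)² - f²) T f = (2f + 1) T f`.
  linear_combination e₂ - ((f : C(I, ℝ)) + 1) ^ 2 * e + (f : C(I, ℝ)) ^ 2 * e₁

end Algebra

end SmoothDerivation

namespace SmoothDerivation

open Filter Topology Set

/-! ### Gluing, jets, bump series and additive functions on the line -/

section Real

/-- Gluing `F` to `0` at a point where all derivatives of `F` up to order `k` vanish. -/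
theorem contDiff_indicator_Ici {k : ℕ} {F : ℝ → ℝ} {a : ℝ} (hF : ContDiff ℝ k F)
    (h : ∀ j ≤ k, iteratedDeriv j F a = 0) : ContDiff ℝ k ((Ici a).indicator F) := by
  induction k generalizing F with
  | zero =>
    have h0 : F a = 0 := by simpa using h 0 le_rfl
    simp only [Nat.cast_zero, contDiff_zero] at hF ⊢
    refine hF.indicator fun x hx => ?_
    rw [frontier_Ici, mem_singleton_iff] at hx
    rw [hx, h0]
  | succ k ih =>
    have h0 : F a = 0 := by simpa using h 0 (Nat.zero_le _)
    have h1 : deriv F a = 0 := by simpa using h 1 (by omega)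
    push_cast at hF ⊢
    obtain ⟨hd, -, hF'⟩ := contDiff_succ_iff_deriv.1 hF
    -- Differentiation commutes with the cut-off, so the induction passes to `deriv F`. At `a` both
    -- one-sided derivatives are `0`.
    have key (x : ℝ) : HasDerivAt ((Ici a).indicator F) ((Ici a).indicator (deriv F) x) x := by
      rcases lt_trichotomy x a with hx | rfl | hx
      · rw [indicator_of_notMem (by simpa using hx)]
        refine (hasDerivAt_const x (0 : ℝ)).congr_of_eventuallyEq ?_
        filter_upwards [Iio_mem_nhds hx] with y hy
        exact indicator_of_notMem (by simpa using hy) F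
      · rw [indicator_of_mem self_mem_Ici, h1]
        have hl : HasDerivWithinAt ((Ici x).indicator F) 0 (Iic x) x := by
          refine (hasDerivWithinAt_const x (Iic x) (0 : ℝ)).congr_of_mem (fun y hy => ?_)
            self_mem_Iic
          rcases eq_or_lt_of_le (mem_Iic.1 hy) with rfl | hy
          · rw [indicator_of_mem self_mem_Ici, h0]
          · exact indicator_of_notMem (by simpa using hy) F
        have hr : HasDerivWithinAt ((Ici x).indicator F) 0 (Ici x) x := by
          rw [← h1]
          exact (hd x).hasDerivAt.hasDerivWithinAt.congr_of_mem
            (fun y hy => indicator_of_mem hy F) self_mem_Ici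
        have := hl.union hr
        rwa [Iic_union_Ici, hasDerivWithinAt_univ] at this
      · rw [indicator_of_mem (mem_Ici.2 hx.le)]
        refine (hd x).hasDerivAt.congr_of_eventuallyEq ?_
        filter_upwards [Ioi_mem_nhds hx] with y hy
        exact indicator_of_mem (mem_Ici.2 (le_of_lt hy)) F
    refine contDiff_succ_iff_deriv.2 ⟨fun x => (key x).differentiableAt, by simp, ?_⟩
    rw [funext fun x => (key x).deriv]
    refine ih hF' fun j hj => ?_
    rw [← iteratedDeriv_succ']
    exact h (j + 1) (by omega)

theorem iteratedDeriv_polynomial_eval (P : Polynomial ℝ) (j : ℕ) :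
    iteratedDeriv j (fun x => P.eval x) = fun x => (Polynomial.derivative^[j] P).eval x := by
  induction j generalizing P with
  | zero => simp
  | succ j ih =>
    have : deriv (fun x => P.eval x) = fun x => P.derivative.eval x := funext fun x => P.deriv
    rw [iteratedDeriv_succ', this, ih, Function.iterate_succ_apply]

open Polynomial in
/-- Polynomials interpolate jets. -/
theorem exists_polynomial_jet (b : ℕ → ℝ) (a : ℝ) (k : ℕ) :
    ∃ P : ℝ[X], P.natDegree ≤ k ∧ ∀ j ≤ k, (derivative^[j] P).eval a = b j := by
  induction k with
  | zero => exact ⟨C (b 0), by simp, fun j hj => by simp [Nat.le_zero.1 hj]⟩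
  | succ k ih =>
    obtain ⟨P, hP, h⟩ := ih
    -- Adding `c (X - a)^(k+1)` keeps the derivatives at `a` up to order `k` and changes the next
    -- one by `(k+1)! c`.
    let c := (b (k + 1) - (derivative^[k + 1] P).eval a) / (k + 1).factorial
    have hmon (j : ℕ) : (derivative^[j] (C c * (X - C a) ^ (k + 1))).eval a =
        c * ((k + 1).descFactorial j * 0 ^ (k + 1 - j)) := by
      rw [iterate_derivative_C_mul, iterate_derivative_X_sub_pow]
      simp
    refine ⟨P + C c * (X - C a) ^ (k + 1), ?_, fun j hj => ?_⟩
    · refine natDegree_add_le_of_degree_le (hP.trans k.le_succ) ?_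
      refine (natDegree_C_mul_le _ _).trans (natDegree_pow_le.trans ?_)
      rw [natDegree_X_sub_C, mul_one]
    · rw [iterate_map_add, eval_add, hmon]
      rcases Nat.lt_or_ge k j with hj' | hj'
      · obtain rfl : j = k + 1 := by omega
        rw [Nat.sub_self, pow_zero, mul_one, Nat.descFactorial_self]
        have : ((k + 1).factorial : ℝ) ≠ 0 := by positivity
        simp only [c]
        field_simp
        ring
      · rw [h j hj', zero_pow (by omega)]
        ring

/-- A bump function that is `1` near `a` and supported inside `S` cuts `f` off. Locality then allows
working with functions that are `C^k` on the whole line. -/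
theorem exists_contDiff_eventuallyEq {k : ℕ} {f : ℝ → ℝ} {S : Set ℝ} {a : ℝ}
    (hf : ContDiffOn ℝ k f S) (hS : S ∈ 𝓝 a) : ∃ F : ℝ → ℝ, ContDiff ℝ k F ∧ F =ᶠ[𝓝 a] f := by
  obtain ⟨r, hr, hrS⟩ := Metric.mem_nhds_iff.1 hS
  let φ : ContDiffBump a := ⟨r / 4, r / 2, by positivity, by linarith⟩
  refine ⟨fun x => φ x * f x, contDiff_iff_contDiffAt.2 fun x => ?_, ?_⟩
  · by_cases hx : x ∈ Metric.ball a r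
    · exact φ.contDiffAt.mul (hf.contDiffAt (mem_of_superset (Metric.isOpen_ball.mem_nhds hx) hrS))
    · refine (contDiffAt_const (c := (0 : ℝ))).congr_of_eventuallyEq ?_
      have hx' : x ∉ tsupport φ := by
        rw [φ.tsupport_eq]
        simp only [Metric.mem_ball, Metric.mem_closedBall, φ] at hx ⊢
        linarith
      filter_upwards [notMem_tsupport_iff_eventuallyEq.1 hx'] with y hy
      simp [hy]
  · filter_upwards [φ.eventuallyEq_one] with y hy
    simp [hy]

/-- A series of compactly supported functions converges in `C^k` if its coefficients are small. -/
theorem exists_pos_contDiff_tsum (k : ℕ) {φ : ℕ → ℝ → ℝ} (hφ : ∀ n, ContDiff ℝ k (φ n))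
    (hc : ∀ n, HasCompactSupport (φ n)) : ∃ ε : ℕ → ℝ, (∀ n, 0 < ε n) ∧
      ∀ c : ℕ → ℝ, (∀ n, |c n| ≤ ε n) → ContDiff ℝ k fun x => ∑' n, c n * φ n x := by
  have hb (n j : ℕ) : ∃ C, 0 ≤ C ∧ (j ≤ k → ∀ x, ‖iteratedFDeriv ℝ j (φ n) x‖ ≤ C) := by
    by_cases hj : j ≤ k
    · obtain ⟨C, hC⟩ := ((hc n).iteratedFDeriv (𝕜 := ℝ) j).exists_bound_of_continuous
        ((hφ n).continuous_iteratedFDeriv (by exact_mod_cast hj))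
      exact ⟨C, (norm_nonneg _).trans (hC 0), fun _ => hC⟩
    · exact ⟨0, le_rfl, fun h => absurd h hj⟩
  choose C hC0 hC using hb
  -- `M n` bounds all derivatives of `φ n` up to order `k` at once; the `1` makes it positive, so
  -- that it can be divided by.
  let M (n : ℕ) : ℝ := 1 + ∑ j ∈ Finset.range (k + 1), C n j
  have hM (n : ℕ) : 0 < M n := by
    have := Finset.sum_nonneg fun j (_ : j ∈ Finset.range (k + 1)) => hC0 n j
    simp only [M]
    linarith
  refine ⟨fun n => (1 / 2) ^ n / M n, fun n => div_pos (by positivity) (hM n), fun c hcn => ?_⟩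
  refine contDiff_tsum (N := (k : ℕ∞)) (v := fun _ n => (1 / 2) ^ n)
    (fun n => contDiff_const.mul (hφ n)) (fun _ _ => summable_geometric_two) fun j n x hj => ?_
  have hj' : j ≤ k := by exact_mod_cast hj
  have hsmul : iteratedFDeriv ℝ j (c n • φ n) x = c n • iteratedFDeriv ℝ j (φ n) x :=
    iteratedFDeriv_const_smul_apply ((hφ n).contDiffAt.of_le (by exact_mod_cast hj'))
  have hjM : ‖iteratedFDeriv ℝ j (φ n) x‖ ≤ M n := by
    refine (hC n j hj' x).trans ?_
    have := Finset.single_le_sum (fun i _ => hC0 n i) (Finset.mem_range.2 (Nat.lt_succ_of_le hj'))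
    simp only [M]
    linarith
  change ‖iteratedFDeriv ℝ j (c n • φ n) x‖ ≤ _
  rw [hsmul, norm_smul, Real.norm_eq_abs]
  calc |c n| * ‖iteratedFDeriv ℝ j (φ n) x‖ ≤ (1 / 2) ^ n / M n * M n :=
        mul_le_mul (hcn n) hjM (norm_nonneg _) (div_pos (by positivity) (hM n)).le
    _ = (1 / 2) ^ n := div_mul_cancel₀ _ (hM n).ne'

/-- Smooth functions can have any prescribed sufficiently small values at the points `a + δ / 2 ^ n`,
being constant near each of them. -/
theorem exists_contDiff_eventuallyEq_const (k : ℕ) (a : ℝ) {δ : ℝ} (hδ : 0 < δ) :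
    ∃ ε : ℕ → ℝ, (∀ n, 0 < ε n) ∧ ∀ c : ℕ → ℝ, (∀ n, |c n| ≤ ε n) →
      ∃ F : ℝ → ℝ, ContDiff ℝ k F ∧ ∀ n, F =ᶠ[𝓝 (a + δ / 2 ^ n)] fun _ => c n := by
  have hpos (n : ℕ) : 0 < δ / 2 ^ n := by positivity
  -- Any other centre is at distance at least half the larger of the two offsets from `a`. With
  -- these radii all other bumps vanish where the `n`th one is `1`.
  let φ (n : ℕ) : ContDiffBump (a + δ / 2 ^ n) :=
    ⟨δ / 2 ^ n / 8, δ / 2 ^ n / 4, by have := hpos n; positivity, by have := hpos n; linarith⟩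
  have hsep {m n : ℕ} (h : m < n) : δ / 2 ^ n ≤ δ / 2 ^ m / 2 := by
    rw [div_div, ← pow_succ]
    exact div_le_div_of_nonneg_left hδ.le (by positivity) (pow_le_pow_right₀ one_le_two h)
  obtain ⟨ε, hε, H⟩ := exists_pos_contDiff_tsum k (φ := fun n => φ n) (fun n => (φ n).contDiff)
    fun n => (φ n).hasCompactSupport
  refine ⟨ε, hε, fun c hc => ⟨_, H c hc, fun n => ?_⟩⟩
  filter_upwards [Metric.ball_mem_nhds _ (φ n).rIn_pos] with x hx
  rw [tsum_eq_single n, (φ n).one_of_mem_closedBall (Metric.ball_subset_closedBall hx), mul_one]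
  intro m hm
  rw [(φ m).zero_of_le_dist, mul_zero]
  have hx' : |x - (a + δ / 2 ^ n)| < δ / 2 ^ n / 8 := hx
  change δ / 2 ^ m / 4 ≤ |x - (a + δ / 2 ^ m)|
  have hm0 := hpos m
  have hn0 := hpos n
  obtain ⟨h1, h2⟩ := abs_lt.1 hx'
  rcases lt_or_gt_of_ne hm with h | h
  · have := hsep h
    exact le_abs.2 (Or.inr (by linarith))
  · have := hsep h
    exact le_abs.2 (Or.inl (by linarith))

/-- An additive function `ℝ → ℝ` vanishing at `1` but not identically is unbounded near `0`. -/
theorem exists_abs_le_lt_abs_map {D : ℝ →+ ℝ} (h1 : D 1 = 0) {c : ℝ} (hc : D c ≠ 0) {ε : ℝ}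
    (hε : 0 < ε) (N : ℝ) : ∃ b, |b| ≤ ε ∧ N < |D b| := by
  -- `D` is `ℚ`-linear and kills rationals, so `D (m (c - q)) = m D c`: a large `m` makes this
  -- large, and `q` within `ε / m` of `c` keeps the argument small.
  obtain ⟨m, hm⟩ := exists_nat_gt (|N| / |D c|)
  have hDc := abs_pos.2 hc
  have hm0 : (0 : ℝ) < m := lt_of_le_of_lt (by positivity) hm
  obtain ⟨q, hq1, hq2⟩ := exists_rat_btwn (show c - ε / m < c by have := div_pos hε hm0; linarith)
  have hDq : D q = 0 := by
    have := map_rat_smul D q 1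
    rw [h1, smul_zero, Rat.smul_one_eq_cast] at this
    exact this
  refine ⟨m • (c - q), ?_, ?_⟩
  · rw [nsmul_eq_mul, abs_mul, Nat.abs_cast, abs_of_pos (sub_pos.2 hq2), ← le_div_iff₀' hm0]
    linarith
  · rw [map_nsmul, map_sub, hDq, sub_zero, nsmul_eq_mul, abs_mul, Nat.abs_cast]
    exact (le_abs_self N).trans_lt ((div_lt_iff₀ hDc).1 hm)

end Real

end SmoothDerivation

namespace SmoothDerivation

open Filter Topology Set

/-! ### Locality and constants -/

noncomputable section

variable {k : ℕ} {I S : Set ℝ} {hS : S ⊆ I}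

/-- The restriction to `I` of a function that is `C^k` on the whole line. -/
def restrict (hS : S ⊆ I) {F : ℝ → ℝ} (hF : ContDiff ℝ k F) : ckOn k I S hS :=
  ⟨⟨fun x => F x, hF.continuous.comp continuous_subtype_val⟩,
    hF.contDiffOn.congr fun x hx => ext_apply _ ⟨x, hS hx⟩⟩

@[simp]
theorem restrict_apply {F : ℝ → ℝ} (hF : ContDiff ℝ k F) (x : I) :
    (restrict hS hF : C(I, ℝ)) x = F x :=
  rfl

theorem ckOn_ext {f g : ckOn k I S hS} (h : ∀ x : I, (f : C(I, ℝ)) x = (g : C(I, ℝ)) x) : f = g :=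
  Subtype.ext (ContinuousMap.ext h)

/-- A convex subset of the line with two points has nonempty interior, hence lies in the closure of
its interior. Identities in `C(I, ℝ)` thus need checking at interior points only. -/
theorem dense_interior (hI : I.OrdConnected) (hI' : I.Nontrivial) :
    Dense {x : I | (x : ℝ) ∈ interior I} := by
  rw [Subtype.dense_iff]
  have himage : Subtype.val '' {x : I | (x : ℝ) ∈ interior I} = interior I := by
    ext x
    simp only [mem_image, mem_ofPred_eq, Subtype.exists, exists_and_right, exists_eq_right]
    exact ⟨fun h => h.2, fun h => ⟨interior_subset h, h⟩⟩
  rw [himage, (hI.convex (𝕜 := ℝ)).closure_interior_eq_closure_of_nonempty_interior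
    ((hI.convex (𝕜 := ℝ)).nontrivial_iff_nonempty_interior.1 hI')]
  exact subset_closure

theorem eq_of_eq_on_interior (hI : I.OrdConnected) (hI' : I.Nontrivial) {f g : C(I, ℝ)}
    (h : ∀ x : I, (x : ℝ) ∈ interior I → f x = g x) : f = g :=
  DFunLike.coe_injective (f.continuous.ext_on (dense_interior hI hI') g.continuous h)

variable {T : ckOn k I S hS →+ C(I, ℝ)}

/-- Locality. -/
theorem Leibniz.apply_eq_zero (hT : Leibniz T) {f : ckOn k I S hS} {x : I}
    (hf : ∀ᶠ y in 𝓝 x, (f : C(I, ℝ)) y = 0) : T f x = 0 := by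
  rw [nhds_subtype, eventually_comap] at hf
  obtain ⟨r, hr, hrf⟩ := Metric.eventually_nhds_iff_ball.1 hf
  let φ : ContDiffBump (x : ℝ) := ⟨r / 2, r, by positivity, by linarith⟩
  -- Since `f x = 0` and `φ x = 1`, the Leibniz rule for this product reads `0 = T f x` at `x`.
  have h0 : f * restrict hS φ.contDiff = 0 := by
    refine ckOn_ext fun y => ?_
    by_cases hy : (y : ℝ) ∈ Metric.ball (x : ℝ) r
    · simp [hrf y hy y rfl]
    · have : φ y = 0 := φ.zero_of_le_dist (not_lt.1 hy)
      simp [this]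
  have hfx : (f : C(I, ℝ)) x = 0 := hrf x (Metric.mem_ball_self hr) x rfl
  have hφx : φ x = 1 := φ.one_of_mem_closedBall (Metric.mem_closedBall_self φ.rIn_pos.le)
  have := DFunLike.congr_fun (hT f (restrict hS φ.contDiff)) x
  rw [h0] at this
  simpa [hfx, hφx] using this.symm

theorem Leibniz.apply_congr (hT : Leibniz T) {f g : ckOn k I S hS} {x : I}
    (hfg : ∀ᶠ y in 𝓝 x, (f : C(I, ℝ)) y = (g : C(I, ℝ)) y) : T f x = T g x := by
  rw [← sub_eq_zero, ← ContinuousMap.sub_apply, ← map_sub]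
  refine hT.apply_eq_zero ?_
  filter_upwards [hfg] with y hy
  simp [hy]

theorem eventually_coe_mem {x : I} {s : Set ℝ} (hs : s ∈ 𝓝 (x : ℝ)) : ∀ᶠ y : I in 𝓝 x, (y : ℝ) ∈ s :=
  continuous_subtype_val.continuousAt hs

/-- The constant functions are mapped to `0`. -/
theorem Leibniz.map_algebraMap (hI : I.OrdConnected) (hI' : I.Nontrivial) (hT : Leibniz T) (c : ℝ) :
    T (algebraMap ℝ (ckOn k I S hS) c) = 0 := by
  refine eq_of_eq_on_interior hI hI' fun x hx => ?_
  by_contra hcx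
  rw [ContinuousMap.zero_apply] at hcx
  let D (y : I) : ℝ →+ ℝ :=
    { toFun := fun b => T (algebraMap ℝ _ b) y
      map_zero' := by simp
      map_add' := fun a b => by simp }
  have hD1 (y : I) : D y 1 = 0 := by
    change T (algebraMap ℝ _ 1) y = 0
    rw [(algebraMap ℝ (ckOn k I S hS)).map_one, hT.map_one, ContinuousMap.zero_apply]
  have hev : ∀ᶠ y : ℝ in 𝓝 (x : ℝ), ∀ h : y ∈ I, D ⟨y, h⟩ c ≠ 0 := by
    have := (T (algebraMap ℝ _ c)).continuous.continuousAt.eventually_ne hcx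
    rw [nhds_subtype, eventually_comap] at this
    filter_upwards [this] with y hy h
    exact hy ⟨y, h⟩ rfl
  obtain ⟨r, hr, hrI⟩ := Metric.eventually_nhds_iff_ball.1
    (hev.and (mem_interior_iff_mem_nhds.1 hx))
  have hmem (n : ℕ) : (x : ℝ) + r / 2 / 2 ^ n ∈ Metric.ball (x : ℝ) r := by
    have : r / 2 / 2 ^ n ≤ r / 2 := div_le_self (by positivity) (one_le_pow₀ one_le_two)
    rw [Metric.mem_ball, Real.dist_eq, add_sub_cancel_left, abs_of_pos (by positivity)]
    linarith
  let p (n : ℕ) : I := ⟨_, (hrI _ (hmem n)).2⟩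
  obtain ⟨ε, hε, H⟩ := exists_contDiff_eventuallyEq_const k (x : ℝ) (half_pos hr)
  -- The value `b n` is adapted to the map `D (p n)` at the point where it will be used: small
  -- enough for `F` to be `C^k`, yet with `|D (p n) (b n)| > n`.
  choose b hbε hbD using fun n : ℕ =>
    exists_abs_le_lt_abs_map (hD1 (p n)) ((hrI _ (hmem n)).1 (p n).2) (hε n) n
  obtain ⟨F, hF, hFb⟩ := H b hbε
  have hTF (n : ℕ) : T (restrict hS hF) (p n) = D (p n) (b n) :=
    hT.apply_congr (eventually_coe_mem (x := p n) (hFb n))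
  have hp : Tendsto p atTop (𝓝 x) := by
    rw [tendsto_subtype_rng]
    have h2 : Tendsto (fun n : ℕ => (2 : ℝ) ^ n) atTop atTop :=
      tendsto_pow_atTop_atTop_of_one_lt one_lt_two
    simpa [p] using (h2.const_div_atTop (r / 2)).const_add (x : ℝ)
  have hlim := (((T (restrict hS hF)).continuous.tendsto x).comp hp).abs
  refine not_tendsto_nhds_of_tendsto_atTop (tendsto_atTop_mono (fun n => ?_)
    tendsto_natCast_atTop_atTop) _ hlim
  rw [Function.comp_apply, hTF]
  exact (hbD n).le

/-! ### Polynomials and dependence on the jet -/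

theorem contDiff_polynomial_eval (P : Polynomial ℝ) : ContDiff ℝ k fun x => P.eval x :=
  P.contDiff_aeval k

theorem Leibniz.map_polynomial (hI : I.OrdConnected) (hI' : I.Nontrivial) (hT : Leibniz T)
    (P : Polynomial ℝ) (x : I) :
    T (restrict hS (contDiff_polynomial_eval P)) x =
      T (restrict hS contDiff_id) x * P.derivative.eval (x : ℝ) := by
  have hC (a : ℝ) : T (restrict hS (contDiff_polynomial_eval (Polynomial.C a))) = 0 := by
    rw [← hT.map_algebraMap hI hI' a]
    congr 1
    refine ckOn_ext fun y => ?_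
    rw [restrict_apply, Polynomial.eval_C]
    rfl
  induction P using Polynomial.induction_on with
  | C a => rw [hC]; simp
  | add P Q hP hQ =>
    have : restrict hS (contDiff_polynomial_eval (k := k) (P + Q)) =
        restrict hS (contDiff_polynomial_eval P) + restrict hS (contDiff_polynomial_eval Q) :=
      ckOn_ext fun y => by simp
    rw [this, map_add, ContinuousMap.add_apply, hP, hQ]
    simp only [Polynomial.derivative_add, Polynomial.eval_add]
    ring
  | monomial n a ih =>
    have : restrict hS (contDiff_polynomial_eval (k := k)
          (Polynomial.C a * Polynomial.X ^ (n + 1))) =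
        restrict hS (contDiff_polynomial_eval (Polynomial.C a * Polynomial.X ^ n)) *
          restrict hS contDiff_id :=
      ckOn_ext fun y => by simp [pow_succ, mul_assoc]
    have hder : (Polynomial.derivative (Polynomial.C a * Polynomial.X ^ (n + 1))).eval (x : ℝ) =
        (Polynomial.derivative (Polynomial.C a * Polynomial.X ^ n)).eval (x : ℝ) * x +
          (Polynomial.C a * Polynomial.X ^ n).eval (x : ℝ) := by
      rw [pow_succ, ← mul_assoc, Polynomial.derivative_mul, Polynomial.derivative_X, mul_one,
        Polynomial.eval_add, Polynomial.eval_mul_X]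
    rw [this, hT, ContinuousMap.add_apply, ContinuousMap.mul_apply, ContinuousMap.mul_apply, ih,
      hder, restrict_apply, restrict_apply, id]
    ring

theorem apply_eq_zero_of_forall_mem {f : C(I, ℝ)} {x : I} {s : Set ℝ}
    (hx : x ∈ closure {y : I | (y : ℝ) ∈ s}) (h : ∀ y : I, (y : ℝ) ∈ s → f y = 0) : f x = 0 :=
  closure_minimal (s := {y : I | (y : ℝ) ∈ s}) (t := f ⁻¹' {0}) h
    (isClosed_singleton.preimage f.continuous) hx

theorem mem_closure_of_mem_interior {x : I} (hx : (x : ℝ) ∈ interior I) {s : Set ℝ}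
    (hs : (x : ℝ) ∈ closure s) : x ∈ closure {y : I | (y : ℝ) ∈ s} := by
  rw [mem_closure_iff_nhds] at hs ⊢
  intro t ht
  rw [nhds_subtype, mem_comap] at ht
  obtain ⟨u, hu, hut⟩ := ht
  obtain ⟨y, ⟨hyu, hyI⟩, hys⟩ := hs _ (inter_mem hu (mem_interior_iff_mem_nhds.1 hx))
  exact ⟨⟨y, hyI⟩, hut hyu, hys⟩

/-- If all derivatives of `F` up to order `k` vanish at an interior point, so does `T F`. -/
theorem Leibniz.apply_restrict_eq_zero (hT : Leibniz T) {F : ℝ → ℝ} (hF : ContDiff ℝ k F) {x : I}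
    (hx : (x : ℝ) ∈ interior I) (h : ∀ j ≤ k, iteratedDeriv j F x = 0) :
    T (restrict hS hF) x = 0 := by
  -- The part `G` of `F` on `[x, ∞)` vanishes to the left of `x` and `F - G` to the right. Locality
  -- kills each image on an open side, continuity at `x`.
  have hG := contDiff_indicator_Ici hF h
  have hsplit : restrict hS hF = restrict hS hG + restrict hS (hF.sub hG) :=
    ckOn_ext fun y => by simp
  have h1 : T (restrict hS hG) x = 0 := by
    refine apply_eq_zero_of_forall_mem (s := Iio (x : ℝ))
      (mem_closure_of_mem_interior hx (by simp)) fun y hy => hT.apply_eq_zero ?_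
    filter_upwards [eventually_coe_mem (Iio_mem_nhds hy)] with z hz
    exact indicator_of_notMem (by simpa using hz) F
  have h2 : T (restrict hS (hF.sub hG)) x = 0 := by
    refine apply_eq_zero_of_forall_mem (s := Ioi (x : ℝ))
      (mem_closure_of_mem_interior hx (by simp)) fun y hy => hT.apply_eq_zero ?_
    filter_upwards [eventually_coe_mem (Ioi_mem_nhds hy)] with z hz
    rw [restrict_apply, indicator_of_mem (mem_Ici.2 (le_of_lt hz)), sub_self]
  rw [hsplit, map_add, ContinuousMap.add_apply, h1, h2, add_zero]

/-- `P` has the same `k`-jet at `x` as `f`, so `T` cannot distinguish them there. The degree bound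
settles `k = 0`, where `P` is constant. -/
theorem Leibniz.exists_polynomial (hI : I.OrdConnected) (hI' : I.Nontrivial) (hT : Leibniz T)
    (hIS : interior I ⊆ S) (f : ckOn k I S hS) {x : I} (hx : (x : ℝ) ∈ interior I) :
    ∃ P : Polynomial ℝ, P.natDegree ≤ k ∧
      (0 < k → HasDerivAt (ext (f : C(I, ℝ))) (P.derivative.eval (x : ℝ)) x) ∧
      T f x = T (restrict hS contDiff_id) x * P.derivative.eval (x : ℝ) := by
  have hSx : S ∈ 𝓝 (x : ℝ) := mem_of_superset (isOpen_interior.mem_nhds hx) hIS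
  obtain ⟨F, hF, hFf⟩ := exists_contDiff_eventuallyEq (show ContDiffOn ℝ k _ S from f.2) hSx
  obtain ⟨P, hP, hPF⟩ := exists_polynomial_jet (fun j => iteratedDeriv j F x) (x : ℝ) k
  have hP' := contDiff_polynomial_eval (k := k) P
  refine ⟨P, hP, fun hk => ?_, ?_⟩
  · have h1 : P.derivative.eval (x : ℝ) = deriv F x := by simpa using hPF 1 hk
    rw [h1]
    have hd := hF.differentiable (by exact_mod_cast hk.ne') (x : ℝ)
    exact hd.hasDerivAt.congr_of_eventuallyEq hFf.symm
  · have hjet (j : ℕ) (hj : j ≤ k) : iteratedDeriv j (F - fun y => P.eval y) x = 0 := by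
      have hj' : (j : WithTop ℕ∞) ≤ k := by exact_mod_cast hj
      rw [iteratedDeriv_sub (hF.contDiffAt.of_le hj') (hP'.contDiffAt.of_le hj'),
        iteratedDeriv_polynomial_eval, ← hPF j hj, sub_self]
    have h0 := hT.apply_restrict_eq_zero (hS := hS) (hF.sub hP') hx hjet
    have hsub : restrict hS (hF.sub hP') = restrict hS hF - restrict hS hP' :=
      ckOn_ext fun y => by simp
    rw [hsub, map_sub, ContinuousMap.sub_apply, sub_eq_zero, hT.map_polynomial hI hI'] at h0
    rw [← h0]
    refine hT.apply_congr ?_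
    filter_upwards [eventually_coe_mem hFf] with y hy
    rw [restrict_apply, ← ext_apply]
    exact hy.symm

theorem Leibniz.eq_zero (hI : I.OrdConnected) (hI' : I.Nontrivial) (hT : Leibniz T)
    (hIS : interior I ⊆ S) (hk : k = 0) : T = 0 := by
  refine AddMonoidHom.ext fun f => eq_of_eq_on_interior hI hI' fun x hx => ?_
  obtain ⟨P, hP, -, h⟩ := hT.exists_polynomial hI hI' hIS f hx
  rw [h, Polynomial.derivative_of_natDegree_zero (by omega)]
  simp

/-! ### End points, the product rule and the equivalences -/

/-- At a point where `f` is differentiable within `I`, its difference quotients are values of the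
derivative at nearby interior points. -/
theorem exists_hasDerivAt_slope (hI : I.OrdConnected) {f : C(I, ℝ)}
    (hd : ∀ x ∈ interior I, DifferentiableAt ℝ (ext f) x) {x y : I} (hxy : y ≠ x) :
    ∃ z : I, (z : ℝ) ∈ interior I ∧ |(z : ℝ) - x| ≤ |(y : ℝ) - x| ∧
      HasDerivAt (ext f) (slope (ext f) x y) z := by
  have hcont : ContinuousOn (ext f) I := by
    rw [continuousOn_iff_continuous_domRestrict]
    convert f.continuous using 1
    exact funext (ext_apply f)
  have key {a b : I} (hab : (a : ℝ) < b) : ∃ z : I, (z : ℝ) ∈ interior I ∧ (z : ℝ) ∈ Ioo (a : ℝ) b ∧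
      HasDerivAt (ext f) (slope (ext f) a b) z := by
    have hsub : Icc (a : ℝ) b ⊆ I := hI.out a.2 b.2
    have hsub' : Ioo (a : ℝ) b ⊆ interior I :=
      isOpen_Ioo.subset_interior_iff.2 (Ioo_subset_Icc_self.trans hsub)
    obtain ⟨z, hz, hzd⟩ := exists_deriv_eq_slope (ext f) hab (hcont.mono hsub)
      fun z hz => (hd z (hsub' hz)).differentiableWithinAt
    refine ⟨⟨z, interior_subset (hsub' hz)⟩, hsub' hz, hz, ?_⟩
    rw [slope_def_field, ← hzd]
    exact (hd z (hsub' hz)).hasDerivAt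
  rcases lt_or_gt_of_ne (Subtype.coe_injective.ne hxy) with h | h
  · obtain ⟨z, hz, hz', hzd⟩ := key h
    refine ⟨z, hz, ?_, by rwa [slope_comm]⟩
    rw [abs_of_neg (sub_neg.2 hz'.2), abs_of_neg (sub_neg.2 h)]
    linarith [hz'.1]
  · obtain ⟨z, hz, hz', hzd⟩ := key h
    refine ⟨z, hz, ?_, hzd⟩
    rw [abs_of_pos (sub_pos.2 hz'.1), abs_of_pos (sub_pos.2 h)]
    linarith [hz'.2]

/-- Take `d = T(id)`. The formula at interior points `ξ y` where the derivative equals the slope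
from `x` to `y` passes to the limit `y → x`. Continuity of the derivative at `x` is not needed,
which covers end points in `ckInt`. -/
theorem Leibniz.isMultipleOfDeriv (hI : I.OrdConnected) (hI' : I.Nontrivial) (hT : Leibniz T)
    (hIS : interior I ⊆ S) (hk : 0 < k) : IsMultipleOfDeriv T := by
  refine ⟨T (restrict hS contDiff_id), fun f x f' hf' => ?_⟩
  have hint {z : I} (hz : (z : ℝ) ∈ interior I) {v : ℝ}
      (hv : HasDerivAt (ext (f : C(I, ℝ))) v z) : T f z = T (restrict hS contDiff_id) z * v := by
    obtain ⟨P, -, h1, h2⟩ := hT.exists_polynomial hI hI' hIS f hz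
    rw [h2, (h1 hk).unique hv]
  have hd (z : ℝ) (hz : z ∈ interior I) : DifferentiableAt ℝ (ext (f : C(I, ℝ))) z := by
    obtain ⟨P, -, h1, -⟩ := hT.exists_polynomial hI hI' hIS f (x := ⟨z, interior_subset hz⟩) hz
    exact (h1 hk).differentiableAt
  choose! ξ hξ hξx hξd using fun (y : I) (hy : y ≠ x) => exists_hasDerivAt_slope hI hd hy
  have hne : (𝓝[≠] x).NeBot := by
    have : Nontrivial I := nontrivial_coe_sort.2 hI'
    have : PreconnectedSpace I := isPreconnected_iff_preconnectedSpace.1 hI.isPreconnected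
    infer_instance
  have hξlim : Tendsto ξ (𝓝[≠] x) (𝓝 x) := by
    rw [tendsto_iff_dist_tendsto_zero]
    refine squeeze_zero' (Eventually.of_forall fun _ => dist_nonneg)
      (eventually_mem_nhdsWithin.mono fun y hy => hξx y hy) (g := fun y => dist y x) ?_
    exact (tendsto_iff_dist_tendsto_zero.1 tendsto_id).mono_left nhdsWithin_le_nhds
  have hslope : Tendsto (fun y : I => slope (ext (f : C(I, ℝ))) x y) (𝓝[≠] x) (𝓝 f') := by
    refine (hasDerivWithinAt_iff_tendsto_slope.1 hf').comp
      (tendsto_nhdsWithin_iff.2 ⟨?_, ?_⟩)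
    · exact (continuous_subtype_val.tendsto x).mono_left nhdsWithin_le_nhds
    · filter_upwards [eventually_mem_nhdsWithin] with y hy
      exact ⟨y.2, Subtype.coe_injective.ne hy⟩
  refine tendsto_nhds_unique (((T f).continuous.tendsto x).comp hξlim)
    (((((T (restrict hS contDiff_id)).continuous.tendsto x).comp hξlim).mul hslope).congr' ?_)
  filter_upwards [eventually_mem_nhdsWithin] with y hy
  exact (hint (hξ y hy) (hξd y hy)).symm

theorem ext_mul (f g : C(I, ℝ)) : ext (f * g) = ext f * ext g := by
  funext x
  by_cases hx : x ∈ I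
  · have h (f : C(I, ℝ)) : ext f x = f ⟨x, hx⟩ := ext_apply f ⟨x, hx⟩
    simp [h]
  · have h (f : C(I, ℝ)) : ext f x = 0 := Function.extend_apply' _ _ _ (by simpa using hx)
    simp [h]

theorem IsMultipleOfDeriv.leibniz (hI : I.OrdConnected) (hI' : I.Nontrivial)
    (hT : IsMultipleOfDeriv T) (hIS : interior I ⊆ S) (hk : 0 < k) : Leibniz T := by
  obtain ⟨d, hd⟩ := hT
  intro f g
  refine eq_of_eq_on_interior hI hI' fun x hx => ?_
  have hder (f : ckOn k I S hS) : HasDerivWithinAt (ext (f : C(I, ℝ)))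
      (deriv (ext (f : C(I, ℝ))) x) I x := by
    have hf : ContDiffOn ℝ k (ext (f : C(I, ℝ))) S := f.2
    have := hf.contDiffAt (mem_of_superset (isOpen_interior.mem_nhds hx) hIS)
    exact (this.differentiableAt (by exact_mod_cast hk.ne')).hasDerivAt.hasDerivWithinAt
  have hfg := (hder f).mul (hder g)
  rw [← ext_mul] at hfg
  rw [hd (f * g) x _ hfg, ContinuousMap.add_apply, ContinuousMap.mul_apply,
    ContinuousMap.mul_apply, hd f x _ (hder f), hd g x _ (hder g), ext_apply, ext_apply]
  ring

theorem tfae_ckOn {Q : Prop} (hQ : Leibniz T ↔ Q) :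
    List.TFAE [SquareRule T, Leibniz T, PowerRule T, Q] := by
  tfae_have 1 → 2 := SquareRule.leibniz
  tfae_have 2 → 3 := Leibniz.powerRule
  tfae_have 3 → 1 := PowerRule.squareRule
  tfae_have 2 ↔ 4 := hQ
  tfae_finish

theorem tfae_ckOn_of_isCompact (hI : IsCompact I) {Q : Prop} (hQ : Leibniz T ↔ Q) :
    List.TFAE [Leibniz T, LeibnizPos T, SquareRule T, SquareRulePos T, InverseRulePos T,
      PowerRule T, PowerRulePos T, Q] := by
  tfae_have 1 → 2 := Leibniz.pos
  -- The only implication that uses compactness.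
  tfae_have 2 → 1 := LeibnizPos.leibniz hI
  tfae_have 3 → 1 := SquareRule.leibniz
  tfae_have 2 → 4 := LeibnizPos.squareRulePos
  tfae_have 4 → 2 := SquareRulePos.leibnizPos
  tfae_have 1 → 5 := Leibniz.inverseRulePos
  tfae_have 5 → 4 := InverseRulePos.squareRulePos exists_inv_ckOn
  tfae_have 1 → 6 := Leibniz.powerRule
  tfae_have 6 → 3 := PowerRule.squareRule
  tfae_have 6 → 7 := PowerRule.pos
  tfae_have 7 → 4 := PowerRulePos.squareRulePos
  tfae_have 1 ↔ 8 := hQ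
  tfae_finish

theorem leibniz_iff_isMultipleOfDeriv (hI : I.OrdConnected) (hI' : I.Nontrivial)
    (hIS : interior I ⊆ S) (hk : 0 < k) : Leibniz T ↔ IsMultipleOfDeriv T :=
  ⟨fun h => h.isMultipleOfDeriv hI hI' hIS hk, fun h => h.leibniz hI hI' hIS hk⟩

theorem leibniz_iff_eq_zero (hI : I.OrdConnected) (hI' : I.Nontrivial)
    (hIS : interior I ⊆ S) (hk : k = 0) : Leibniz T ↔ T = 0 :=
  ⟨fun h => h.eq_zero hI hI' hIS hk, fun h f g => by simp [h]⟩

end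

end SmoothDerivation

theorem corollary2 (k : ℕ) (I : Set ℝ) (hI : I.OrdConnected) (hI' : I.Nontrivial)
    (A : Subalgebra ℝ C(I, ℝ))
    (hA : A = SmoothDerivation.ck k I ∨ A = SmoothDerivation.ckInt k I)
    (T : A →+ C(I, ℝ)) :
    (0 < k →
      List.TFAE [
        SmoothDerivation.SquareRule T,
        SmoothDerivation.Leibniz T,
        SmoothDerivation.PowerRule T,
        SmoothDerivation.IsMultipleOfDeriv T]) ∧
    (k = 0 →
      List.TFAE [
        SmoothDerivation.SquareRule T,
        SmoothDerivation.Leibniz T,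
        SmoothDerivation.PowerRule T,
        T = 0]) ∧
    (IsCompact I →
      (0 < k →
        List.TFAE [
          SmoothDerivation.Leibniz T,
          SmoothDerivation.LeibnizPos T,
          SmoothDerivation.SquareRule T,
          SmoothDerivation.SquareRulePos T,
          SmoothDerivation.InverseRulePos T,
          SmoothDerivation.PowerRule T,
          SmoothDerivation.PowerRulePos T,
          SmoothDerivation.IsMultipleOfDeriv T]) ∧
      (k = 0 →
        List.TFAE [
          SmoothDerivation.Leibniz T,
          SmoothDerivation.LeibnizPos T,
          SmoothDerivation.SquareRule T,
          SmoothDerivation.SquareRulePos T,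
          SmoothDerivation.InverseRulePos T,
          SmoothDerivation.PowerRule T,
          SmoothDerivation.PowerRulePos T,
          T = 0])) := by
  -- Both algebras are instances of `ckOn`, and the argument needs only `interior I ⊆ S ⊆ I`.
  obtain ⟨S, hS, hIS, rfl⟩ : ∃ (S : Set ℝ) (hS : S ⊆ I), interior I ⊆ S ∧
      A = SmoothDerivation.ckOn k I S hS := by
    rcases hA with rfl | rfl
    · exact ⟨I, subset_rfl, interior_subset, rfl⟩
    · exact ⟨interior I, interior_subset, subset_rfl, rfl⟩
  have hpos (hk : 0 < k) :=
    SmoothDerivation.leibniz_iff_isMultipleOfDeriv (T := T) hI hI' hIS hk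
  have hzero (hk : k = 0) := SmoothDerivation.leibniz_iff_eq_zero (T := T) hI hI' hIS hk
  exact ⟨fun hk => SmoothDerivation.tfae_ckOn (hpos hk),
    fun hk => SmoothDerivation.tfae_ckOn (hzero hk), fun hc =>
    ⟨fun hk => SmoothDerivation.tfae_ckOn_of_isCompact hc (hpos hk),
      fun hk => SmoothDerivation.tfae_ckOn_of_isCompact hc (hzero hk)⟩⟩
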